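/- Let $\mathcal H$ be a complex separable infinite-dimensional Hilbert space and let $M>1$. Let $\mathfrak B_M(\mathcal H)$ be the set of all bounded linear operators $T$ on $\mathcal H$ with $\|T\|\le M$, and let $\mathrm{CH}_M(\mathcal H)$ be the set of all $T\in\mathfrak B_M(\mathcal H)$ which are chaotic, that is, such that some $x\in\mathcal H$ has a dense orbit $\{T^nx:\ n\ge 0\}$ and the periodic points of $T$ (the vectors $x$ with $T^Nx=x$ for some $N\ge 1$) are dense in $\mathcal H$. Let $\mathtt{SOT}$ be the strong operator topology (in which $T_i\to T$ if and only if $T_ix\to Tx$ in norm for every $x\in\mathcal H$), and let $\mathtt{SOT}^*$ be the strong$^*$ operator topology (in which $T_i\to T$ if and only if $T_ix\to Tx$ and $T_i^*x\to T^*x$ in norm for every $x\in\mathcal H$). In a topological space, $\mathbf\Sigma^0_1$ sets are the open sets, $\mathbf\Pi^0_n$ sets are the complements of $\mathbf\Sigma^0_n$ sets, and, for $n\ge 2$, $\mathbf\Sigma^0_n$ sets are the countable unions of sets each of which is $\mathbf\Pi^0_m$ for some $1\le m<n$. Then: 1. $\mathrm{CH}_M(\mathcal H)$ is a $\mathbf\Pi^0_4$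 subset of $(\mathfrak B_M(\mathcal H),\mathtt{SOT})$; 2. $\mathrm{CH}_M(\mathcal H)$ is a true $\mathbf\Pi^0_3$ subset of $(\mathfrak B_M(\mathcal H),\mathtt{SOT}^*)$, i.e. it is $\mathbf\Pi^0_3$ but not $\mathbf\Sigma^0_3$ in this space. -/

import Mathlib

/-! ### The finite levels of the Borel hierarchy -/

/-- `IsSigma0 τ n s`: the set `s` is of class `Σ⁰ₙ` for the topology `τ`. The class `Σ⁰₁` consists
of the open sets, and for `n ≥ 2` the class `Σ⁰ₙ` consists of the countable unions `⋃ₖ Aₖ` in which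
each `Aₖ` is of class `Π⁰_{m k}` (that is, its complement is of class `Σ⁰_{m k}`) for some
`1 ≤ m k < n`. No set is of class `Σ⁰₀`, so that the second constructor yields nothing
when `n ≤ 1`. -/
inductive IsSigma0 {X : Type*} (τ : TopologicalSpace X) : ℕ → Set X → Prop
  | of_isOpen {s : Set X} (hs : @IsOpen X τ s) : IsSigma0 τ 1 s
  | of_iUnion {n : ℕ} {s : Set X} (A : ℕ → Set X) (m : ℕ → ℕ) (hm : ∀ k, m k < n)
      (hA : ∀ k, IsSigma0 τ (m k) (A k)ᶜ) (hs : s = ⋃ k, A k) : IsSigma0 τ n s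

/-- The set `s` is of class `Π⁰ₙ` for `τ`: its complement is of class `Σ⁰ₙ`. -/
def IsPi0 {X : Type*} (τ : TopologicalSpace X) (n : ℕ) (s : Set X) : Prop :=
  IsSigma0 τ n sᶜ

/-- The set `s` is a true `Π⁰ₙ` set for `τ`: it is `Π⁰ₙ` and not `Σ⁰ₙ`. -/
def IsTruePi0 {X : Type*} (τ : TopologicalSpace X) (n : ℕ) (s : Set X) : Prop :=
  IsPi0 τ n s ∧ ¬ IsSigma0 τ n s

/-! ### Operator topologies -/

section Operators

variable (H : Type*) [NormedAddCommGroup H] [InnerProductSpace ℂ H]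

/-- The strong operator topology on `𝔅(H)`, i.e. the topology of pointwise convergence in norm. -/
noncomputable abbrev sotTopology : TopologicalSpace (H →L[ℂ] H) :=
  TopologicalSpace.induced
    (ContinuousLinearMap.toPointwiseConvergenceCLM ℂ (RingHom.id ℂ) H H) inferInstance

/-- The strong* operator topology on `𝔅(H)`: the coarsest topology for which both `T ↦ T` and
`T ↦ T*` are continuous into `𝔅(H)` with the strong operator topology. -/
noncomputable abbrev sotStarTopology [CompleteSpace H] : TopologicalSpace (H →L[ℂ] H) :=
  sotTopology H ⊓
    TopologicalSpace.induced (fun T : H →L[ℂ] H => ContinuousLinearMap.adjoint T) (sotTopology H)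

/-- The closed ball `𝔅_M(H) = {T ∈ 𝔅(H) : ‖T‖ ≤ M}`. -/
abbrev OperatorBall (M : ℝ) : Type _ := {T : H →L[ℂ] H // ‖T‖ ≤ M}

/-- The strong operator topology on `𝔅_M(H)`. -/
noncomputable abbrev ballSOT (M : ℝ) : TopologicalSpace (OperatorBall H M) :=
  TopologicalSpace.induced Subtype.val (sotTopology H)

/-- The strong* operator topology on `𝔅_M(H)`. -/
noncomputable abbrev ballSOTStar [CompleteSpace H] (M : ℝ) : TopologicalSpace (OperatorBall H M) :=
  TopologicalSpace.induced Subtype.val (sotStarTopology H)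

/-! ### Chaotic operators -/

variable {H} in
/-- `T` is hypercyclic: some vector has a dense orbit `{Tⁿ x : n ≥ 0}`. -/
def IsHypercyclic (T : H →L[ℂ] H) : Prop :=
  ∃ x : H, Dense (Set.range fun n : ℕ => (T ^ n) x)

variable {H} in
/-- `T` is chaotic: it is hypercyclic and its periodic points are dense in `H`. -/
def IsChaotic (T : H →L[ℂ] H) : Prop :=
  IsHypercyclic T ∧ Dense (Function.periodicPts (T : H → H))

/-- The set `CH_M(H)` of chaotic operators in the ball `𝔅_M(H)`. -/
def chaoticSet (M : ℝ) : Set (OperatorBall H M) :=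
  {T | IsChaotic (T : H →L[ℂ] H)}

end Operators

/-!
Upper bounds. By Birkhoff's transitivity theorem, hypercyclicity is a countable intersection of
open conditions, already for the strong topology. The periodic points of `T` are dense if and only
if each closed ball `B` of a countable family contains a fixed point of `T ^ N` for some `N ≥ 1`.
With `A = T ^ N - 1` and `B` of centre `z` and radius `r`, such a fixed point exists if and only if
the distance of `z` to `ker A` is at most `r`, and since `(ker A)ᗮ` is the closure of the range of
`A†` this means that `|⟪z, A† u⟫| ≤ r ‖A† u‖` for all `u`
(`exists_mem_closedBall_apply_eq_zero_iff`). On bounded sets this is a strong* closed condition, so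
that the chaotic operators form a `Π⁰₃` set for the strong* topology
(`isPi0_three_setOf_isChaotic`). On the ball, the strong* topology is second countable and its open
sets are `Fσ` for the strong topology (`isSigma0_two_ballSOT_of_isOpen_ballSOTStar`); passing from
one topology to the other thus costs one level.

Lower bound. The set of all `α : ℕ → ℕ → Bool` whose columns are all eventually `false` is not a
countable union of `Gδ` sets, by a double application of Baire's theorem
(`ne_iUnion_isGδ_of_forall_eventually_eq_false`). It is reduced continuously to the set of chaotic
operators: with a Hilbert basis indexed by `ℕ × ℕ`, the operator attached to `α` is a direct sum of
weighted backward shifts, one for each column. The products of the first weights of a shift are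
multiplied by `M` at each `false` of the column and reset to `1` at each `true`. If all columns are
eventually `false`, the products grow geometrically, all basis vectors have summable backward
orbits, and a chaos criterion applies (`IsShiftSum.isChaotic`). If a column has infinitely many
`true`, the first coordinate of every periodic point in the corresponding summand vanishes, since
the products do not tend to infinity along any arithmetic progression `N, 2N, …`
(`IsShiftSum.repr_eq_zero_of_mem_periodicPts`).
-/

open Set Filter Topology

/-! ### The low levels of the Borel hierarchy -/

theorem not_isSigma0_zero {X : Type*} {τ : TopologicalSpace X} {s : Set X} :
    ¬ IsSigma0 τ 0 s := by
  intro h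
  cases h with
  | of_iUnion A m hm => exact absurd (hm 0) (by omega)

theorem isSigma0_one_iff {X : Type*} [τ : TopologicalSpace X] {s : Set X} :
    IsSigma0 τ 1 s ↔ IsOpen s := by
  refine ⟨fun h => ?_, .of_isOpen⟩
  cases h with
  | of_isOpen hs => exact hs
  | of_iUnion A m hm hA =>
    have h0 : m 0 = 0 := by have := hm 0; omega
    exact absurd (h0 ▸ hA 0) not_isSigma0_zero

theorem isSigma0_two_iff {X : Type*} [τ : TopologicalSpace X] {s : Set X} :
    IsSigma0 τ 2 s ↔ IsGδ sᶜ := by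
  rw [isGδ_iff_eq_iInter_nat]
  constructor
  · intro h
    cases h with
    | of_iUnion A m hm hA hs =>
      refine ⟨fun k => (A k)ᶜ, fun k => ?_, by rw [hs, compl_iUnion]⟩
      have h1 : m k = 1 := by
        have h0 : m k ≠ 0 := fun h => not_isSigma0_zero (h ▸ hA k)
        have := hm k
        omega
      exact isSigma0_one_iff.1 (h1 ▸ hA k)
  · rintro ⟨f, hf, hs⟩
    refine .of_iUnion (fun k => (f k)ᶜ) (fun _ => 1) (by simp) (fun k => ?_) ?_
    · rw [compl_compl]
      exact .of_isOpen (hf k)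
    · rw [← compl_iInter, ← hs, compl_compl]

/-- The preimage of a `Σ⁰₃` set under a continuous map from a pseudometrizable space is a countable
union of `Gδ` sets. No assumption is made on the target: its closed sets need not be `Gδ`. -/
theorem IsSigma0.exists_preimage_eq_iUnion_isGδ {X Y : Type*} [TopologicalSpace X]
    [TopologicalSpace.PseudoMetrizableSpace X] [τ : TopologicalSpace Y] {f : X → Y}
    (hf : Continuous f) {s : Set Y} (hs : IsSigma0 τ 3 s) :
    ∃ B : ℕ → Set X, (∀ k, IsGδ (B k)) ∧ f ⁻¹' s = ⋃ k, B k := by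
  cases hs with
  | of_iUnion A m hm hA hs =>
    refine ⟨fun k => f ⁻¹' A k, fun k => ?_, by rw [hs, preimage_iUnion]⟩
    have h0 : m k ≠ 0 := fun h => not_isSigma0_zero (h ▸ hA k)
    obtain h1 | h2 : m k = 1 ∨ m k = 2 := by have := hm k; omega
    · have hc : IsClosed (A k) := isOpen_compl_iff.1 (isSigma0_one_iff.1 (h1 ▸ hA k))
      let := TopologicalSpace.pseudoMetrizableSpacePseudoMetric X
      exact (hc.preimage hf).isGδ
    · have : IsGδ (A k) := by
        rw [← compl_compl (A k)]
        exact isSigma0_two_iff.1 (h2 ▸ hA k)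
      exact this.preimage hf

theorem isPi0_succ_iInter {X : Type*} {τ : TopologicalSpace X} {ι : Type*} [Countable ι]
    [Nonempty ι] {n : ℕ} {B : ι → Set X} (m : ι → ℕ) (hm : ∀ i, m i ≤ n)
    (hB : ∀ i, IsSigma0 τ (m i) (B i)) : IsPi0 τ (n + 1) (⋂ i, B i) := by
  obtain ⟨e, he⟩ := exists_surjective_nat ι
  refine .of_iUnion (fun k => (B (e k))ᶜ) (fun k => m (e k))
    (fun k => Nat.lt_succ_of_le (hm _)) (fun k => by simpa using hB (e k)) ?_
  rw [compl_iInter, he.iUnion_comp (g := fun i => (B i)ᶜ)]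

/-- A map of the first Borel class raises the level of a set by at most one under preimages. -/
theorem IsSigma0.preimage_succ {X Y : Type*} {τ : TopologicalSpace X} {σ : TopologicalSpace Y}
    {f : X → Y} (hf : ∀ U, IsOpen[σ] U → IsSigma0 τ 2 (f ⁻¹' U)) {n : ℕ} {s : Set Y}
    (hs : IsSigma0 σ n s) : IsSigma0 τ (n + 1) (f ⁻¹' s) := by
  induction hs with
  | of_isOpen hs => exact hf _ hs
  | of_iUnion A m hm hA hs ih =>
    exact .of_iUnion (fun k => f ⁻¹' A k) (fun k => m k + 1) (fun k => by have := hm k; omega)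
      ih (by rw [hs, preimage_iUnion])

theorem IsPi0.preimage_succ {X Y : Type*} {τ : TopologicalSpace X} {σ : TopologicalSpace Y}
    {f : X → Y} (hf : ∀ U, IsOpen[σ] U → IsSigma0 τ 2 (f ⁻¹' U)) {n : ℕ} {s : Set Y}
    (hs : IsPi0 σ n s) : IsPi0 τ (n + 1) (f ⁻¹' s) :=
  IsSigma0.preimage_succ hf hs

/-- In a second countable space, countably many finite intersections of subbasic sets suffice to
cover an open set. -/
theorem TopologicalSpace.exists_countable_iUnion_sInter_of_isOpen {X : Type*}
    [t : TopologicalSpace X] [SecondCountableTopology X] {g : Set (Set X)}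
    (ht : t = TopologicalSpace.generateFrom g) {U : Set X} (hU : IsOpen U) :
    ∃ 𝓕 : Set (Set (Set X)), 𝓕.Countable ∧ (∀ F ∈ 𝓕, F.Finite ∧ F ⊆ g) ∧ U = ⋃ F ∈ 𝓕, ⋂₀ F := by
  have hbasis := TopologicalSpace.isTopologicalBasis_of_subbasis ht
  obtain ⟨𝓢, h𝓢, rfl⟩ := hbasis.open_eq_sUnion hU
  obtain ⟨𝓣, h𝓣, hsub, heq⟩ :=
    TopologicalSpace.isOpen_sUnion_countable 𝓢 fun s hs => hbasis.isOpen (h𝓢 hs)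
  have h𝓣g : ∀ s ∈ 𝓣, ∃ F : Set (Set X), (F.Finite ∧ F ⊆ g) ∧ ⋂₀ F = s :=
    fun s hs => h𝓢 (hsub hs)
  choose! F hFg hF using h𝓣g
  refine ⟨F '' 𝓣, h𝓣.image _, by rintro _ ⟨s, hs, rfl⟩; exact hFg s hs, ?_⟩
  rw [← heq, sUnion_eq_biUnion, biUnion_image]
  exact iUnion₂_congr fun s hs => (hF s hs).symm

/-- If a second countable topology `σ` has a subbasis of `Fσ` sets of `τ`, then all its open sets
are `Fσ` sets of `τ`. -/
theorem isSigma0_two_of_isOpen_generateFrom {X : Type*} {σ τ : TopologicalSpace X}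
    (h2 : @SecondCountableTopology X σ) {g : Set (Set X)}
    (hσ : σ = TopologicalSpace.generateFrom g)
    (hg : ∀ s ∈ g, IsSigma0 τ 2 s) {U : Set X} (hU : IsOpen[σ] U) : IsSigma0 τ 2 U := by
  obtain ⟨𝓕, h𝓕, h𝓕g, rfl⟩ :=
    @TopologicalSpace.exists_countable_iUnion_sInter_of_isOpen X σ h2 g hσ U hU
  rw [isSigma0_two_iff, compl_iUnion₂]
  refine .biInter h𝓕 fun F hF => ?_
  rw [compl_sInter]
  refine .sUnion ((h𝓕g F hF).1.image _) ?_
  rintro _ ⟨u, hu, rfl⟩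
  exact isSigma0_two_iff.1 (hg u ((h𝓕g F hF).2 hu))

/-! ### A set of double sequences which is not a countable union of `Gδ` sets -/

/-- The set of double sequences all of whose columns are eventually `false` is not a countable union
of `Gδ` sets. Apply Baire's theorem to the finer topology in which columns are discrete: one of the
`Gδ` sets is dense in a cylinder `{α | α m = c m, m < J}` for that topology, hence for the
usual topology of the cylinder, where it is comeagre. But generically the column `J` takes the value
`true` infinitely often. -/
theorem ne_iUnion_isGδ_of_forall_eventually_eq_false {B : ℕ → Set (ℕ → ℕ → Bool)}
    (hB : ∀ k, IsGδ (B k)) :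
    {α : ℕ → ℕ → Bool | ∀ m, ∀ᶠ n in atTop, α m n = false} ≠ ⋃ k, B k := by
  intro hP
  -- Binary expansion enumerates the eventually vanishing columns.
  let Ψ : (ℕ → ℕ) → ℕ → ℕ → Bool := fun y m n => (y m).testBit n
  have hΨc : Continuous Ψ := by
    refine continuous_pi fun m => continuous_pi fun n => ?_
    exact (continuous_of_discreteTopology (f := fun a : ℕ => a.testBit n)).comp (continuous_apply m)
  have hΨd : DenseRange Ψ := by
    intro α
    refine mem_closure_of_tendsto (f := fun N : ℕ => Ψ fun m => Nat.ofBits fun i : Fin N => α m i)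
      (b := atTop) ?_ (.of_forall fun N => mem_range_self _)
    refine tendsto_pi_nhds.2 fun m => tendsto_pi_nhds.2 fun n => tendsto_const_nhds.congr' ?_
    filter_upwards [eventually_gt_atTop n] with N hN
    simp [Ψ, Nat.testBit_ofBits_lt _ _ hN]
  have hcov : ⋃ k, closure (Ψ ⁻¹' B k) = univ := by
    refine eq_univ_of_forall fun y => ?_
    have : Ψ y ∈ ⋃ k, B k := by
      rw [← hP]
      intro m
      filter_upwards [eventually_ge_atTop (y m)] with n hn
      exact Nat.testBit_lt_two_pow (hn.trans_lt Nat.lt_two_pow_self)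
    obtain ⟨k, hk⟩ := mem_iUnion.1 this
    exact mem_iUnion.2 ⟨k, subset_closure hk⟩
  obtain ⟨k, y₀, hy₀⟩ := nonempty_interior_of_iUnion_of_closed (fun _ => isClosed_closure) hcov
  obtain ⟨J, hJ⟩ : ∃ J : ℕ, {y : ℕ → ℕ | ∀ m < J, y m = y₀ m} ⊆ closure (Ψ ⁻¹' B k) := by
    obtain ⟨-, ⟨x, J, rfl⟩, hmem, hsub⟩ :=
      (PiNat.isTopologicalBasis_cylinders fun _ : ℕ => ℕ).exists_subset_of_mem_open hy₀
        isOpen_interior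
    rw [← PiNat.mem_cylinder_iff_eq.1 hmem] at hsub
    exact ⟨J, hsub.trans interior_subset⟩
  have hcyl : IsOpen {y : ℕ → ℕ | ∀ m < J, y m = y₀ m} :=
    PiNat.isOpen_cylinder (fun _ : ℕ => ℕ) y₀ J
  let θ : (ℕ → ℕ → Bool) → ℕ → ℕ → Bool := fun β m => if m < J then Ψ y₀ m else β m
  have hθ : Continuous θ := by
    refine continuous_pi fun m => ?_
    by_cases hm : m < J
    · simpa [θ, hm] using continuous_const
    · simpa [θ, hm] using continuous_apply m
  have hdense : Dense (θ ⁻¹' B k) := by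
    rw [dense_iff_inter_open]
    intro O hO hne
    obtain ⟨y, hy⟩ := hΨd.exists_mem_open hO hne
    let patch : (ℕ → ℕ) → ℕ → ℕ := fun z m => if m < J then y m else z m
    have hpatch : Continuous patch := by
      refine continuous_pi fun m => ?_
      by_cases hm : m < J
      · simpa [patch, hm] using continuous_const
      · simpa [patch, hm] using continuous_apply m
    let y' : ℕ → ℕ := fun m => if m < J then y₀ m else y m
    have hy' : y' ∈ closure (Ψ ⁻¹' B k) := hJ fun m hm => by simp [y', hm]
    obtain ⟨z, ⟨hz1, hz2⟩, hz3⟩ := mem_closure_iff.1 hy'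
      ((fun z => Ψ (patch z)) ⁻¹' O ∩ {y | ∀ m < J, y m = y₀ m})
      ((hO.preimage (hΨc.comp hpatch)).inter hcyl)
      ⟨by
        have : patch y' = y := by ext m; by_cases hm : m < J <;> simp [patch, y', hm]
        simpa [this] using hy, fun m hm => by simp [y', hm]⟩
    refine ⟨Ψ (patch z), hz1, ?_⟩
    have : θ (Ψ (patch z)) = Ψ z := by
      ext m n
      by_cases hm : m < J
      · simp [θ, Ψ, hm, hz2 m hm]
      · simp [θ, Ψ, patch, hm]
    simpa [this] using hz3
  have hGeq : {β : ℕ → ℕ → Bool | ∃ᶠ n in atTop, β J n = true} =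
      ⋂ i : ℕ, {β | ∃ n, i ≤ n ∧ β J n = true} := by
    ext β
    simp [frequently_atTop]
  have hGo : ∀ i : ℕ, IsOpen {β : ℕ → ℕ → Bool | ∃ n, i ≤ n ∧ β J n = true} := by
    intro i
    simp only [ofPred_exists]
    refine isOpen_iUnion fun n => isOpen_const.and ?_
    exact (isOpen_discrete {true}).preimage
      ((continuous_apply n).comp (continuous_apply (A := fun _ : ℕ => ℕ → Bool) J))
  have hGd : ∀ i : ℕ, Dense {β : ℕ → ℕ → Bool | ∃ n, i ≤ n ∧ β J n = true} := by
    intro i β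
    refine mem_closure_of_tendsto (b := atTop)
      (f := fun N : ℕ => fun m n => if m = J ∧ N ≤ n then true else β m n) ?_
      (.of_forall fun N => ⟨max i N, le_max_left _ _, by simp⟩)
    refine tendsto_pi_nhds.2 fun m => tendsto_pi_nhds.2 fun n => tendsto_const_nhds.congr' ?_
    filter_upwards [eventually_gt_atTop n] with N hN
    simp [hN]
  have hG : IsGδ {β : ℕ → ℕ → Bool | ∃ᶠ n in atTop, β J n = true} := by
    rw [hGeq]
    exact .iInter_of_isOpen hGo
  have hGdense : Dense {β : ℕ → ℕ → Bool | ∃ᶠ n in atTop, β J n = true} := by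
    rw [hGeq]
    exact dense_iInter_of_isOpen hGo hGd
  obtain ⟨β, hβ1, hβ2⟩ := (hGdense.inter_of_Gδ hG ((hB k).preimage hθ) hdense).nonempty
  have h1 : θ β ∈ ⋃ k, B k := mem_iUnion.2 ⟨k, hβ2⟩
  rw [← hP] at h1
  obtain ⟨n, hn1, hn2⟩ := (hβ1.and_eventually (h1 J)).exists
  simp [θ, hn1] at hn2

/-! ### Hypercyclicity and chaos for a single operator -/

section Dynamics

variable {H : Type*} [NormedAddCommGroup H] [InnerProductSpace ℂ H]

/-- Birkhoff's transitivity theorem. -/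
theorem isHypercyclic_iff_forall_isOpen [CompleteSpace H] [TopologicalSpace.SeparableSpace H]
    [Nontrivial H] {T : H →L[ℂ] H} {b : Set (Set H)} (hb : TopologicalSpace.IsTopologicalBasis b)
    (hbc : b.Countable) (hbe : ∅ ∉ b) :
    IsHypercyclic T ↔ ∀ U ∈ b, ∀ V ∈ b, ∃ n : ℕ, ∃ x ∈ U, (T ^ n) x ∈ V := by
  have hne : ∀ U ∈ b, U.Nonempty := fun U hU =>
    nonempty_iff_ne_empty.2 fun h => hbe (h ▸ hU)
  have : ∀ x : H, NeBot (𝓝[≠] x) := fun x => Module.punctured_nhds_neBot ℂ H x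
  constructor
  · rintro ⟨x, hx⟩ U hU V hV
    obtain ⟨_, ⟨n, rfl⟩, hn⟩ := hx.exists_mem_open (hb.isOpen hU) (hne U hU)
    -- Deleting the first `n` points of the orbit leaves it dense.
    have hd := hx.sdiff_finite (((finite_lt_nat n).image fun k => (T ^ k) x))
    obtain ⟨_, ⟨⟨m, rfl⟩, hm'⟩, hm⟩ := hd.exists_mem_open (hb.isOpen hV) (hne V hV)
    have hnm : n ≤ m := by
      by_contra! h
      exact hm' ⟨m, h, rfl⟩
    refine ⟨m - n, (T ^ n) x, hn, ?_⟩
    rw [← mul_apply_eq_comp, ← pow_add, Nat.sub_add_cancel hnm]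
    exact hm
  · intro h
    have hd : Dense (⋂ V ∈ b, ⋃ n : ℕ, (T ^ n : H →L[ℂ] H) ⁻¹' V) := by
      refine dense_biInter_of_isOpen (fun V hV => ?_) hbc fun V hV => ?_
      · exact isOpen_iUnion fun n => (hb.isOpen hV).preimage (T ^ n).continuous
      · refine hb.dense_iff.2 fun U hU _ => ?_
        obtain ⟨n, x, hxU, hxV⟩ := h U hU V hV
        exact ⟨x, hxU, mem_iUnion.2 ⟨n, hxV⟩⟩
    obtain ⟨x, hx⟩ := hd.nonempty
    refine ⟨x, hb.dense_iff.2 fun V hV _ => ?_⟩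
    obtain ⟨n, hn⟩ := mem_iUnion.1 (mem_iInter₂.1 hx V hV)
    exact ⟨_, hn, n, rfl⟩

/-- The vectors which are annihilated by some power of `T` and which start an absolutely summable
backward orbit. -/
def summableBackwardOrbits (T : H →L[ℂ] H) : Submodule ℂ H where
  carrier := {v | (∀ᶠ n : ℕ in atTop, (T ^ n) v = 0) ∧
    ∃ a : ℕ → H, a 0 = v ∧ (∀ j, T (a (j + 1)) = a j) ∧ Summable fun j => ‖a j‖}
  zero_mem' := ⟨by simp, 0, by simp, by simp, by simp⟩
  add_mem' := by
    rintro v w ⟨hv, a, ha0, ha, has⟩ ⟨hw, b, hb0, hb, hbs⟩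
    refine ⟨?_, a + b, by simp [ha0, hb0], by simp [ha, hb], ?_⟩
    · filter_upwards [hv, hw] with n h1 h2
      rw [map_add, h1, h2, add_zero]
    · exact .of_nonneg_of_le (fun _ => norm_nonneg _) (fun j => norm_add_le _ _) (has.add hbs)
  smul_mem' := by
    rintro c v ⟨hv, a, ha0, ha, has⟩
    refine ⟨?_, c • a, by simp [ha0], by simp [ha], ?_⟩
    · filter_upwards [hv] with n h1
      rw [map_smul, h1, smul_zero]
    · simpa [norm_smul] using has.mul_left ‖c‖

theorem pow_apply_backwardOrbit {T : H →L[ℂ] H} {a : ℕ → H} (ha : ∀ j, T (a (j + 1)) = a j)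
    (n j : ℕ) : (T ^ n) (a (j + n)) = a j := by
  induction n with
  | zero => simp
  | succ n ih => rw [pow_succ, mul_apply_eq_comp, ← add_assoc, ha, ih]

/-- If `a` is a summable backward orbit of `v` and `T ^ N` annihilates `v`, then `∑ₖ a (k N)` is a
fixed point of `T ^ N`, and it tends to `v` as `N → ∞`. -/
theorem mem_closure_periodicPts_of_mem_summableBackwardOrbits [CompleteSpace H] {T : H →L[ℂ] H}
    {v : H} (hv : v ∈ summableBackwardOrbits T) :
    v ∈ closure (Function.periodicPts (T : H → H)) := by
  obtain ⟨hv, a, ha0, ha, has⟩ := hv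
  have hsum : ∀ N : ℕ, 0 < N → Summable fun k : ℕ => ‖a (k * N)‖ := fun N hN =>
    has.comp_injective (mul_left_injective₀ hN.ne')
  refine mem_closure_of_tendsto (f := fun N : ℕ => ∑' k, a (k * N)) (b := atTop) ?_ ?_
  · have htail : Tendsto (fun N => ∑' j, ‖a (j + N)‖) atTop (𝓝 0) :=
      tendsto_sum_nat_add fun j => ‖a j‖
    rw [tendsto_iff_norm_sub_tendsto_zero]
    refine squeeze_zero' (.of_forall fun _ => norm_nonneg _) ?_ htail
    filter_upwards [eventually_gt_atTop 0] with N hN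
    have hs := hsum N hN
    have hs' : Summable fun k : ℕ => ‖a (k * N + N)‖ := by
      simpa [add_mul] using (summable_nat_add_iff 1).2 hs
    rw [hs.of_norm.tsum_eq_zero_add]
    simp only [zero_mul, ha0, add_sub_cancel_left, add_mul, one_mul]
    refine (norm_tsum_le_tsum_norm hs').trans ?_
    exact tsum_comp_le_tsum_of_inj ((summable_nat_add_iff N).2 has) (fun _ => norm_nonneg _)
      (mul_left_injective₀ hN.ne')
  · filter_upwards [eventually_gt_atTop 0, hv] with N hN hvN
    have hs := (hsum N hN).of_norm
    refine ⟨N, hN, ?_⟩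
    rw [Function.IsPeriodicPt, Function.IsFixedPt, ← FunLike.coe_pow_eq_iterate,
      ContinuousLinearMap.map_tsum _ hs,
      (((T ^ N).summable hs)).tsum_eq_zero_add]
    simp only [zero_mul, ha0, hvN, zero_add, add_mul, one_mul]
    exact tsum_congr fun k => pow_apply_backwardOrbit ha N (k * N)

/-- A chaos criterion: a dense set of vectors annihilated by some power of `T` and having summable
backward orbits. For hypercyclicity, `u + aₙ` is close to `u` and is sent by `T ^ n` to `v`, if `a`
is the backward orbit of `v`. -/
theorem isChaotic_of_dense_summableBackwardOrbits [CompleteSpace H]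
    [TopologicalSpace.SeparableSpace H] [Nontrivial H] {T : H →L[ℂ] H}
    (hT : Dense (summableBackwardOrbits T : Set H)) : IsChaotic T := by
  refine ⟨?_, ?_⟩
  · have hb := TopologicalSpace.isBasis_countableBasis H
    refine (isHypercyclic_iff_forall_isOpen hb (TopologicalSpace.countable_countableBasis H)
      (TopologicalSpace.empty_notMem_countableBasis H)).2 fun U hU V hV => ?_
    obtain ⟨u, hu, huU⟩ := hT.exists_mem_open (hb.isOpen hU)
      (TopologicalSpace.nonempty_of_mem_countableBasis hU)
    obtain ⟨v, hv, hvV⟩ := hT.exists_mem_open (hb.isOpen hV)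
      (TopologicalSpace.nonempty_of_mem_countableBasis hV)
    obtain ⟨hu0, -⟩ := hu
    obtain ⟨-, a, ha0, ha, has⟩ := hv
    have hlim : Tendsto (fun n => u + a n) atTop (𝓝 u) := by
      simpa using (tendsto_zero_iff_norm_tendsto_zero.2 has.tendsto_atTop_zero).const_add u
    obtain ⟨n, h1, h2⟩ := ((hlim.eventually ((hb.isOpen hU).mem_nhds huU)).and hu0).exists
    refine ⟨n, u + a n, h1, ?_⟩
    have := pow_apply_backwardOrbit ha n 0
    rw [zero_add] at this
    rwa [map_add, h2, this, zero_add, ha0]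
  · exact dense_closure.1 (hT.mono fun v hv =>
      mem_closure_periodicPts_of_mem_summableBackwardOrbits hv)

end Dynamics

/-! ### Bounded, strongly continuous families of operators -/

section Families

variable {H : Type*} [NormedAddCommGroup H] [InnerProductSpace ℂ H]
  {X : Type*} [TopologicalSpace X] {F : X → H →L[ℂ] H} {M : ℝ}

theorem continuous_clm_apply_of_norm_le (hM : ∀ x, ‖F x‖ ≤ M)
    (hF : ∀ y, Continuous fun x => F x y) {g : X → H} (hg : Continuous g) :
    Continuous fun x => F x (g x) := by
  refine continuous_iff_continuousAt.2 fun x₀ => ?_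
  have h1 : Tendsto (fun x => F x (g x - g x₀)) (𝓝 x₀) (𝓝 0) := by
    refine squeeze_zero_norm (a := fun x => M * ‖g x - g x₀‖)
      (fun x => (F x).le_of_opNorm_le (hM x) _) ?_
    have : Tendsto (fun x => M * ‖g x - g x₀‖) (𝓝 x₀) (𝓝 (M * ‖g x₀ - g x₀‖)) :=
      (((hg.sub continuous_const).norm).const_mul M).tendsto x₀
    simpa using this
  have h2 := h1.add ((hF (g x₀)).tendsto x₀)
  simpa [ContinuousAt] using h2

theorem continuous_clm_pow_apply_of_norm_le (hM : ∀ x, ‖F x‖ ≤ M)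
    (hF : ∀ y, Continuous fun x => F x y) (n : ℕ) (y : H) :
    Continuous fun x => (F x ^ n) y := by
  induction n with
  | zero => simpa using continuous_const
  | succ n ih =>
    simp only [pow_succ', mul_apply_eq_comp]
    exact continuous_clm_apply_of_norm_le hM hF ih

/-- In a bounded family, strong continuity need only be tested on a set with dense span. -/
theorem continuous_clm_apply_of_dense_span (hM : ∀ x, ‖F x‖ ≤ M) {s : Set H}
    (hs : (Submodule.span ℂ s).topologicalClosure = ⊤)
    (hF : ∀ y ∈ s, Continuous fun x => F x y) (y : H) : Continuous fun x => F x y := by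
  have hspan : ∀ y ∈ Submodule.span ℂ s, Continuous fun x => F x y := by
    intro y hy
    induction hy using Submodule.span_induction with
    | mem y hy => exact hF y hy
    | zero => simpa using continuous_const
    | add y z _ _ h1 h2 => simpa using! h1.add h2
    | smul c y _ h => simpa using! h.const_smul c
  refine continuous_of_uniform_approx_of_continuous fun u hu => ?_
  obtain ⟨ε, hε, hεu⟩ := Metric.mem_uniformity_dist.1 hu
  have hy : y ∈ closure (Submodule.span ℂ s : Set H) := by
    rw [← Submodule.topologicalClosure_coe, hs]
    trivial
  have hM' : 0 < |M| + 1 := by positivity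
  obtain ⟨z, hz, hyz⟩ := Metric.mem_closure_iff.1 hy (ε / (|M| + 1)) (by positivity)
  refine ⟨fun x => F x z, hspan z hz, fun x => hεu ?_⟩
  rw [dist_eq_norm] at hyz ⊢
  rw [← map_sub]
  calc ‖F x (y - z)‖ ≤ (|M| + 1) * ‖y - z‖ :=
        (F x).le_of_opNorm_le ((hM x).trans (by linarith [le_abs_self M])) _
    _ < (|M| + 1) * (ε / (|M| + 1)) := by gcongr
    _ = ε := by field_simp

/-! ### Chaos is a `Π⁰₃` condition for the strong* topology -/

open scoped InnerProductSpace in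
theorem norm_le_of_norm_inner_self_le {w : H} {r : ℝ} (hr : 0 ≤ r)
    (h : ‖⟪w, w⟫_ℂ‖ ≤ r * ‖w‖) : ‖w‖ ≤ r := by
  rw [inner_self_eq_norm_sq_to_K, norm_pow, RCLike.norm_ofReal, abs_norm, sq] at h
  rcases (norm_nonneg w).eq_or_lt with h0 | h0
  · rwa [← h0]
  · exact le_of_mul_le_mul_right h h0

open scoped InnerProductSpace in
/-- The kernel of `A` meets the closed ball of centre `z` and radius `r` if and only if
`|⟪z, A† u⟫| ≤ r ‖A† u‖` for all `u`: the distance of `z` to `ker A` is the norm of the projection of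
`z` to `(ker A)ᗮ`, which is the closure of the range of `A†`. The right-hand side is a closed
condition on `A†` for the topology of pointwise convergence, with no compactness needed. -/
theorem exists_mem_closedBall_apply_eq_zero_iff [CompleteSpace H] (A : H →L[ℂ] H) (z : H) {r : ℝ}
    (hr : 0 ≤ r) :
    (∃ x ∈ Metric.closedBall z r, A x = 0) ↔
      ∀ u, ‖⟪z, ContinuousLinearMap.adjoint A u⟫_ℂ‖ ≤ r * ‖ContinuousLinearMap.adjoint A u‖ := by
  constructor
  · rintro ⟨x, hx, hAx⟩ u
    have h0 : ⟪x, ContinuousLinearMap.adjoint A u⟫_ℂ = 0 := by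
      rw [ContinuousLinearMap.adjoint_inner_right, hAx, inner_zero_left]
    have h1 : ⟪z, ContinuousLinearMap.adjoint A u⟫_ℂ =
        ⟪z - x, ContinuousLinearMap.adjoint A u⟫_ℂ := by
      rw [inner_sub_left, h0, sub_zero]
    rw [h1]
    refine (norm_inner_le_norm _ _).trans ?_
    gcongr
    rwa [← dist_eq_norm, dist_comm]
  · intro h
    have hcl : ∀ w ∈ A.kerᗮ, ‖⟪z, w⟫_ℂ‖ ≤ r * ‖w‖ := by
      intro w hw
      rw [ContinuousLinearMap.orthogonal_ker] at hw
      have hc : IsClosed {w : H | ‖⟪z, w⟫_ℂ‖ ≤ r * ‖w‖} :=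
        isClosed_le (by fun_prop) (by fun_prop)
      refine closure_minimal ?_ hc hw
      rintro _ ⟨u, rfl⟩
      exact h u
    have : CompleteSpace A.ker := A.isClosed_ker.completeSpace_coe
    obtain ⟨x, hx, w, hw, hz⟩ := A.ker.exists_add_mem_mem_orthogonal z
    refine ⟨x, ?_, hx⟩
    have h1 := hcl w hw
    rw [hz, inner_add_left, (Submodule.mem_orthogonal _ _).1 hw x hx, zero_add] at h1
    rw [mem_closedBall_iff_norm', hz, add_sub_cancel_left]
    exact norm_le_of_norm_inner_self_le hr h1

open scoped InnerProductSpace in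
theorem isClosed_setOf_exists_mem_closedBall_pow_apply_eq [CompleteSpace H]
    (hM : ∀ x, ‖F x‖ ≤ M)
    (hF' : ∀ y, Continuous fun x => ContinuousLinearMap.adjoint (F x) y) (N : ℕ) (z : H) {r : ℝ}
    (hr : 0 ≤ r) : IsClosed {x | ∃ y ∈ Metric.closedBall z r, (F x ^ N) y = y} := by
  have h1 : ∀ x y, (F x ^ N) y = y ↔ (F x ^ N - 1) y = 0 := fun x y => by
    rw [sub_apply, one_apply_eq_self, sub_eq_zero]
  simp only [h1, exists_mem_closedBall_apply_eq_zero_iff _ _ hr, ofPred_forall]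
  have hadj : ∀ x u, ContinuousLinearMap.adjoint (F x ^ N - 1) u =
      (ContinuousLinearMap.adjoint (F x) ^ N) u - u := fun x u => by
    rw [← ContinuousLinearMap.star_eq_adjoint, star_sub, star_pow, star_one]
    rfl
  have hc : ∀ u, Continuous fun x => ContinuousLinearMap.adjoint (F x ^ N - 1) u := fun u => by
    simp only [hadj]
    exact (continuous_clm_pow_apply_of_norm_le
      (fun x => (LinearIsometryEquiv.norm_map _ _).trans_le (hM x)) hF' N u).sub continuous_const
  exact isClosed_iInter fun u => isClosed_le (continuous_const.inner (hc u)).norm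
    ((hc u).norm.const_mul r)

/-- Hypercyclicity is a countable intersection of open conditions by Birkhoff's theorem. Density of
the periodic points says that each ball of a countable family, which may be taken closed, meets the
fixed space of some power `F x ^ (N + 1)`, which for fixed `N` is a closed condition on `x`. -/
theorem isPi0_three_setOf_isChaotic [CompleteSpace H] [TopologicalSpace.SeparableSpace H]
    [Nontrivial H] {X : Type*} [τ : TopologicalSpace X] {F : X → H →L[ℂ] H} (hM : ∀ x, ‖F x‖ ≤ M)
    (hF : ∀ y, Continuous fun x => F x y)
    (hF' : ∀ y, Continuous fun x => ContinuousLinearMap.adjoint (F x) y) :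
    IsPi0 τ 3 {x | IsChaotic (F x)} := by
  let b := TopologicalSpace.countableBasis H
  let d := TopologicalSpace.denseSeq H
  have hb : TopologicalSpace.IsTopologicalBasis b := TopologicalSpace.isBasis_countableBasis H
  have : Countable b := (TopologicalSpace.countable_countableBasis H).to_subtype
  let O : (b × b) → Set X := fun p => {x | ∃ n : ℕ, ∃ y ∈ p.1.1, (F x ^ n) y ∈ p.2.1}
  let P : (ℕ × ℕ) → Set X := fun p => {x | ∃ N : ℕ,
    ∃ y ∈ Metric.closedBall (d p.1) (1 / (p.2 + 1 : ℝ)), (F x ^ (N + 1)) y = y}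
  have hO : ∀ p, IsOpen (O p) := by
    intro p
    simp only [O, ofPred_exists]
    refine isOpen_iUnion fun n => isOpen_iUnion fun y => isOpen_const.and ?_
    exact (hb.isOpen p.2.2).preimage (continuous_clm_pow_apply_of_norm_le hM hF n y)
  have hP : ∀ p, IsSigma0 τ 2 (P p) := by
    intro p
    refine .of_iUnion (fun N : ℕ => {x | ∃ y ∈ Metric.closedBall (d p.1) (1 / (p.2 + 1 : ℝ)),
      (F x ^ (N + 1)) y = y}) (fun _ => 1) (by simp) (fun N => .of_isOpen ?_) ?_
    · exact (isClosed_setOf_exists_mem_closedBall_pow_apply_eq hM hF' _ _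
        (by positivity)).isOpen_compl
    · simp only [P, ofPred_exists]
  have heq : {x | IsChaotic (F x)} = ⋂ i, Sum.elim O P i := by
    ext x
    rw [mem_ofPred_eq, mem_iInter, Sum.forall, IsChaotic,
      isHypercyclic_iff_forall_isOpen hb (TopologicalSpace.countable_countableBasis H)
        (TopologicalSpace.empty_notMem_countableBasis H)]
    refine and_congr ?_ ?_
    · simp [O]
    · constructor
      · rintro h ⟨i, k⟩
        obtain ⟨y, ⟨N, hN, hyN⟩, hy⟩ := h.exists_mem_open Metric.isOpen_ball
          ⟨d i, Metric.mem_ball_self (by positivity : (0 : ℝ) < 1 / (k + 1 : ℝ))⟩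
        obtain ⟨N, rfl⟩ := Nat.exists_eq_succ_of_ne_zero (ne_of_gt hN)
        refine ⟨N, y, Metric.ball_subset_closedBall hy, ?_⟩
        rw [FunLike.coe_pow_eq_iterate]
        exact hyN
      · intro h
        refine Metric.dense_iff.2 fun z ε hε => ?_
        obtain ⟨k, hk⟩ := exists_nat_one_div_lt (half_pos hε)
        obtain ⟨i, hi⟩ :=
          (TopologicalSpace.denseRange_denseSeq H).exists_dist_lt z (half_pos hε)
        obtain ⟨N, y, hy, hyN⟩ := h (i, k)
        refine ⟨y, ?_, N + 1, N.succ_pos, ?_⟩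
        · rw [Metric.mem_ball]
          calc dist y z ≤ dist y (d i) + dist (d i) z := dist_triangle _ _ _
            _ < ε / 2 + ε / 2 := add_lt_add ((Metric.mem_closedBall.1 hy).trans_lt hk)
                (by rwa [dist_comm])
            _ = ε := add_halves ε
        · rw [FunLike.coe_pow_eq_iterate] at hyN
          exact hyN
  rw [heq]
  refine isPi0_succ_iInter (Sum.elim (fun _ => 1) fun _ => 2) ?_ ?_
  · rintro (p | p) <;> simp
  · rintro (p | p)
    · exact .of_isOpen (hO p)
    · exact hP p

end Families

/-! ### The topologies on the ball of operators -/

section Topologies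

open scoped PointwiseConvergenceCLM

variable {H : Type*} [NormedAddCommGroup H] [InnerProductSpace ℂ H]

theorem continuous_sotTopology_iff {X : Type*} [TopologicalSpace X] {f : X → H →L[ℂ] H} :
    Continuous[_, sotTopology H] f ↔ ∀ y, Continuous fun x => f x y := by
  rw [continuous_induced_rng]
  exact ⟨fun h y => (continuous_eval_const (F := H →Lₚₜ[ℂ] H) y).comp h,
    PointwiseConvergenceCLM.continuous_of_continuous_eval⟩

theorem continuous_ballSOT_iff {X : Type*} [TopologicalSpace X] {M : ℝ}
    {f : X → OperatorBall H M} :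
    Continuous[_, ballSOT H M] f ↔ ∀ y, Continuous fun x => (f x : H →L[ℂ] H) y := by
  rw [continuous_induced_rng, ← continuous_sotTopology_iff]
  rfl

theorem continuous_ballSOTStar_iff [CompleteSpace H] {X : Type*} [TopologicalSpace X] {M : ℝ}
    {f : X → OperatorBall H M} :
    Continuous[_, ballSOTStar H M] f ↔ (∀ y, Continuous fun x => (f x : H →L[ℂ] H) y) ∧
      ∀ y, Continuous fun x => ContinuousLinearMap.adjoint (f x : H →L[ℂ] H) y := by
  rw [continuous_induced_rng]
  exact continuous_inf_rng.trans (and_congr continuous_sotTopology_iff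
    (continuous_induced_rng.trans continuous_sotTopology_iff))

theorem continuous_ballSOT_apply (M : ℝ) (y : H) :
    Continuous[ballSOT H M, _] fun T : OperatorBall H M => (T : H →L[ℂ] H) y :=
  let := ballSOT H M
  continuous_ballSOT_iff.1 continuous_id y

theorem continuous_ballSOTStar_apply [CompleteSpace H] (M : ℝ) :
    (∀ y, Continuous[ballSOTStar H M, _] fun T : OperatorBall H M => (T : H →L[ℂ] H) y) ∧
      ∀ y, Continuous[ballSOTStar H M, _]
        fun T : OperatorBall H M => ContinuousLinearMap.adjoint (T : H →L[ℂ] H) y :=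
  letI := ballSOTStar H M
  continuous_ballSOTStar_iff.1 continuous_id

theorem isPi0_three_ballSOTStar_chaoticSet [CompleteSpace H] [TopologicalSpace.SeparableSpace H]
    [Nontrivial H] (M : ℝ) : IsPi0 (ballSOTStar H M) 3 (chaoticSet H M) :=
  letI := ballSOTStar H M
  isPi0_three_setOf_isChaotic (fun T : OperatorBall H M => T.2)
    (continuous_ballSOTStar_apply M).1 (continuous_ballSOTStar_apply M).2

/-- The evaluations of `T` and `T†` at the points of a dense sequence. -/
noncomputable def denseEvaluations (H : Type*) [NormedAddCommGroup H] [InnerProductSpace ℂ H]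
    [CompleteSpace H] [TopologicalSpace.SeparableSpace H] (M : ℝ) :
    ℕ ⊕ ℕ → OperatorBall H M → H :=
  Sum.elim (fun i T => (T : H →L[ℂ] H) (TopologicalSpace.denseSeq H i))
    fun i T => ContinuousLinearMap.adjoint (T : H →L[ℂ] H) (TopologicalSpace.denseSeq H i)

/-- On the ball, the strong* topology is the initial topology of countably many maps. -/
theorem ballSOTStar_eq_iInf [CompleteSpace H] [TopologicalSpace.SeparableSpace H] (M : ℝ) :
    ballSOTStar H M = ⨅ j, TopologicalSpace.induced (denseEvaluations H M j) inferInstance := by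
  refine le_antisymm (le_iInf fun j => continuous_iff_le_induced.1 ?_) ?_
  · cases j with
    | inl i => exact (continuous_ballSOTStar_apply M).1 _
    | inr i => exact (continuous_ballSOTStar_apply M).2 _
  · let t : TopologicalSpace (OperatorBall H M) :=
      ⨅ j, TopologicalSpace.induced (denseEvaluations H M j) inferInstance
    have hj : ∀ j, Continuous (denseEvaluations H M j) := fun j =>
      continuous_iInf_dom (i := j) continuous_induced_dom
    have hd : (Submodule.span ℂ (range (TopologicalSpace.denseSeq H))).topologicalClosure = ⊤ := by
      rw [← Submodule.dense_iff_topologicalClosure_eq_top]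
      exact (TopologicalSpace.denseRange_denseSeq H).mono Submodule.subset_span
    refine continuous_id_iff_le.1 (continuous_ballSOTStar_iff.2 ⟨?_, ?_⟩)
    · refine continuous_clm_apply_of_dense_span (M := M) (fun T => T.2) hd ?_
      rintro _ ⟨i, rfl⟩
      exact hj (.inl i)
    · refine continuous_clm_apply_of_dense_span (M := M)
        (fun T => (LinearIsometryEquiv.norm_map _ _).trans_le T.2) hd ?_
      rintro _ ⟨i, rfl⟩
      exact hj (.inr i)

theorem secondCountableTopology_ballSOTStar [CompleteSpace H] [TopologicalSpace.SeparableSpace H]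
    (M : ℝ) : @SecondCountableTopology _ (ballSOTStar H M) := by
  rw [ballSOTStar_eq_iInf]
  exact TopologicalSpace.secondCountableTopology_iInf fun j =>
    TopologicalSpace.secondCountableTopology_induced _ _ _

/-- In a separable space an open set is a countable union of closed balls, so that a map for which
the preimages of closed balls are closed is of the first Borel class. -/
theorem isSigma0_two_preimage_of_isClosed_preimage_closedBall
    {X Y : Type*} {τ : TopologicalSpace X} [PseudoMetricSpace Y] [TopologicalSpace.SeparableSpace Y]
    [Nonempty Y] {f : X → Y} (hf : ∀ y, ∀ r : ℝ, 0 ≤ r → IsClosed (f ⁻¹' Metric.closedBall y r))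
    {U : Set Y} (hU : IsOpen U) : IsSigma0 τ 2 (f ⁻¹' U) := by
  let d := TopologicalSpace.denseSeq Y
  let S : Set (ℕ × ℕ) := {p | Metric.closedBall (d p.1) (1 / (p.2 + 1 : ℝ)) ⊆ U}
  have hUS : U = ⋃ p ∈ S, Metric.closedBall (d p.1) (1 / (p.2 + 1 : ℝ)) := by
    refine subset_antisymm (fun y hy => ?_) (iUnion₂_subset fun p hp => hp)
    obtain ⟨ε, hε, hεU⟩ := Metric.isOpen_iff.1 hU y hy
    obtain ⟨k, hk⟩ := exists_nat_one_div_lt (half_pos hε)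
    obtain ⟨i, hi⟩ := (TopologicalSpace.denseRange_denseSeq Y).exists_dist_lt y
      (by positivity : (0 : ℝ) < 1 / (k + 1 : ℝ))
    refine mem_iUnion₂.2 ⟨(i, k), fun z hz => hεU ?_, hi.le⟩
    rw [Metric.mem_ball]
    calc dist z y ≤ dist z (d i) + dist y (d i) := dist_triangle_right _ _ _
      _ < ε / 2 + ε / 2 := add_lt_add (hz.trans_lt hk) (hi.trans hk)
      _ = ε := add_halves ε
  rw [isSigma0_two_iff, hUS, preimage_iUnion₂, compl_iUnion₂]
  exact .biInter S.to_countable fun p _ => (hf _ _ (by positivity)).isOpen_compl.isGδ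

open scoped InnerProductSpace in
/-- On the ball, the open sets of the strong* topology are `Fσ` sets of the strong topology, because
`‖T† d - z‖ ≤ r` means that `|⟪d, T y⟫ - ⟪z, y⟫| ≤ r ‖y‖` for all `y`. -/
theorem isSigma0_two_ballSOT_of_isOpen_ballSOTStar [CompleteSpace H]
    [TopologicalSpace.SeparableSpace H] {M : ℝ} {U : Set (OperatorBall H M)}
    (hU : IsOpen[ballSOTStar H M] U) : IsSigma0 (ballSOT H M) 2 U := by
  refine isSigma0_two_of_isOpen_generateFrom (secondCountableTopology_ballSOTStar M)
    ((ballSOTStar_eq_iInf M).trans (generateFrom_iUnion_isOpen _).symm) (fun s hs => ?_) hU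
  obtain ⟨j, V, hV, rfl⟩ := mem_iUnion.1 hs
  let := ballSOT H M
  refine isSigma0_two_preimage_of_isClosed_preimage_closedBall (fun z r hr => ?_) hV
  cases j with
  | inl i => exact Metric.isClosed_closedBall.preimage (continuous_ballSOT_apply M _)
  | inr i =>
    set d := TopologicalSpace.denseSeq H i
    have : denseEvaluations H M (.inr i) ⁻¹' Metric.closedBall z r =
        ⋂ y, {T : OperatorBall H M | ‖⟪d, (T : H →L[ℂ] H) y⟫_ℂ - ⟪z, y⟫_ℂ‖ ≤ r * ‖y‖} := by
      ext T
      rw [mem_preimage, mem_closedBall_iff_norm, mem_iInter]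
      change ‖ContinuousLinearMap.adjoint (T : H →L[ℂ] H) d - z‖ ≤ r ↔ _
      set w := ContinuousLinearMap.adjoint (T : H →L[ℂ] H) d - z with hw
      have h1 : ∀ y, ⟪d, (T : H →L[ℂ] H) y⟫_ℂ - ⟪z, y⟫_ℂ = ⟪w, y⟫_ℂ := fun y => by
        rw [hw, inner_sub_left, ContinuousLinearMap.adjoint_inner_left]
      simp only [mem_ofPred_eq, h1]
      refine ⟨fun h y => (norm_inner_le_norm _ _).trans (by gcongr), fun h => ?_⟩
      exact norm_le_of_norm_inner_self_le hr (h w)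
    rw [this]
    exact isClosed_iInter fun y => isClosed_le
      ((continuous_const.inner (continuous_ballSOT_apply M y)).sub continuous_const).norm
      continuous_const

theorem isPi0_four_ballSOT_chaoticSet [CompleteSpace H] [TopologicalSpace.SeparableSpace H]
    [Nontrivial H] (M : ℝ) : IsPi0 (ballSOT H M) 4 (chaoticSet H M) :=
  (isPi0_three_ballSOTStar_chaoticSet M).preimage_succ (f := id) fun _ hU =>
    isSigma0_two_ballSOT_of_isOpen_ballSOTStar hU

end Topologies

/-! ### Weighted shifts along a Hilbert basis -/

section Shifts

variable {H : Type*} [NormedAddCommGroup H] [InnerProductSpace ℂ H]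

theorem Orthonormal.countable_of_separableSpace [TopologicalSpace.SeparableSpace H] {ι : Type*}
    {v : ι → H} (hv : Orthonormal ℂ v) : Countable ι := by
  refine Pairwise.countable_of_isOpen_disjoint (s := fun i => Metric.ball (v i) (1 / 2)) ?_
    (fun _ => Metric.isOpen_ball) fun i => ⟨v i, Metric.mem_ball_self (by norm_num)⟩
  intro i j hij
  refine Metric.ball_disjoint_ball ?_
  have h : ‖v i - v j‖ ^ 2 = 2 := by
    rw [@norm_sub_sq ℂ, hv.2 hij, hv.1 i, hv.1 j]
    norm_num
  rw [dist_eq_norm]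
  nlinarith [norm_nonneg (v i - v j)]

theorem exists_hilbertBasis_of_countable_infinite [CompleteSpace H]
    [TopologicalSpace.SeparableSpace H] (hH : ¬ FiniteDimensional ℂ H) (κ : Type*) [Countable κ]
    [Infinite κ] : Nonempty (HilbertBasis κ ℂ H) := by
  obtain ⟨w, b, -⟩ := exists_hilbertBasis ℂ H
  have : Countable w := b.orthonormal.countable_of_separableSpace
  have : Infinite w := by
    by_contra h
    have : Finite w := not_infinite_iff_finite.1 h
    have := Fintype.ofFinite w
    exact hH b.toOrthonormalBasis.toBasis.finiteDimensional_of_finite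
  obtain ⟨e⟩ : Nonempty (κ ≃ w) := nonempty_equiv_of_countable
  refine ⟨.mk (b.orthonormal.comp e e.injective) ?_⟩
  rw [e.surjective.range_comp, b.dense_span]

/-- The estimate behind the boundedness of the weighted composition operator `f ↦ w • (f ∘ σ)` on
`ℓ²`. -/
theorem lp.sum_norm_weightedComp_rpow_le {ι : Type*} {σ : ι → ι}
    (hσ : Function.Injective σ) {w : ι → ℝ} {M : ℝ} (hM : 0 ≤ M) (hw : ∀ i, |w i| ≤ M)
    (f : lp (fun _ : ι => ℂ) 2) (s : Finset ι) :
    ∑ i ∈ s, ‖(w i : ℂ) * f (σ i)‖ ^ (2 : ENNReal).toReal ≤ (M * ‖f‖) ^ (2 : ENNReal).toReal := by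
  calc ∑ i ∈ s, ‖(w i : ℂ) * f (σ i)‖ ^ (2 : ENNReal).toReal
      ≤ ∑ i ∈ s, M ^ (2 : ENNReal).toReal * ‖f (σ i)‖ ^ (2 : ENNReal).toReal := by
        refine Finset.sum_le_sum fun i _ => ?_
        rw [← Real.mul_rpow hM (norm_nonneg _), norm_mul, Complex.norm_real, Real.norm_eq_abs]
        gcongr
        exact hw i
    _ = M ^ (2 : ENNReal).toReal * ∑ j ∈ s.map ⟨σ, hσ⟩, ‖f j‖ ^ (2 : ENNReal).toReal := by
        rw [Finset.sum_map, Finset.mul_sum]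
        rfl
    _ ≤ M ^ (2 : ENNReal).toReal * ‖f‖ ^ (2 : ENNReal).toReal := by
        gcongr
        exact lp.sum_rpow_le_norm_rpow (by simp) f _
    _ = (M * ‖f‖) ^ (2 : ENNReal).toReal := (Real.mul_rpow hM (norm_nonneg _)).symm

theorem HilbertBasis.exists_weightedComp {ι : Type*} (b : HilbertBasis ι ℂ H) {σ : ι → ι}
    (hσ : Function.Injective σ) {w : ι → ℝ} {M : ℝ} (hM : 0 ≤ M) (hw : ∀ i, |w i| ≤ M) :
    ∃ T : H →L[ℂ] H, ‖T‖ ≤ M ∧ ∀ x i, b.repr (T x) i = w i * b.repr x (σ i) := by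
  let L : H →ₗ[ℂ] H :=
    { toFun := fun x => b.repr.symm ⟨fun i => (w i : ℂ) * b.repr x (σ i),
        memℓp_gen' (lp.sum_norm_weightedComp_rpow_le hσ hM hw (b.repr x))⟩
      map_add' := fun x y => by
        rw [← map_add]
        congr 1
        ext i
        change (w i : ℂ) * b.repr (x + y) (σ i) = _
        rw [map_add]
        exact mul_add (w i : ℂ) (b.repr x (σ i)) (b.repr y (σ i))
      map_smul' := fun c x => by
        rw [RingHom.id_apply, ← map_smul]
        congr 1
        ext i
        simp [mul_left_comm] }
  refine ⟨L.mkContinuous M fun x => ?_, L.mkContinuous_norm_le hM _, fun x i => ?_⟩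
  · simp only [L, LinearMap.coe_mk, AddHom.coe_mk, LinearIsometryEquiv.norm_map]
    refine lp.norm_le_of_forall_sum_le (by simp) (by positivity) fun s => ?_
    simpa using lp.sum_norm_weightedComp_rpow_le hσ hM hw (b.repr x) s
  · simp [L]

/-- The products `p₀ = 1`, `pₙ = w₁ ⋯ wₙ` of the weights of the backward shift coded by a binary
sequence `c`: they are multiplied by `M` at each `false`, and reset to `1` at each `true`. -/
noncomputable def weightProduct (M : ℝ) (c : ℕ → Bool) : ℕ → ℝ
  | 0 => 1
  | n + 1 => if c n then 1 else M * weightProduct M c n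

theorem one_le_weightProduct {M : ℝ} (hM : 1 ≤ M) (c : ℕ → Bool) (n : ℕ) :
    1 ≤ weightProduct M c n := by
  induction n with
  | zero => exact le_rfl
  | succ n ih =>
    rw [weightProduct]
    split_ifs
    · exact le_rfl
    · nlinarith

theorem weightProduct_succ_le {M : ℝ} (hM : 1 ≤ M) (c : ℕ → Bool) (n : ℕ) :
    weightProduct M c (n + 1) ≤ M * weightProduct M c n := by
  have := one_le_weightProduct hM c n
  rw [weightProduct]
  split_ifs
  · nlinarith
  · exact le_rfl

theorem weightProduct_add_le {M : ℝ} (hM : 1 ≤ M) {c : ℕ → Bool} {i : ℕ} (hi : c i = true)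
    (j : ℕ) : weightProduct M c (i + 1 + j) ≤ M ^ j := by
  induction j with
  | zero => simp [weightProduct, hi]
  | succ j ih =>
    rw [pow_succ']
    exact (weightProduct_succ_le hM c _).trans
      (mul_le_mul_of_nonneg_left ih (zero_le_one.trans hM))

theorem summable_inv_weightProduct {M : ℝ} (hM : 1 < M) {c : ℕ → Bool}
    (hc : ∀ᶠ n in atTop, c n = false) : Summable fun n => (weightProduct M c n)⁻¹ := by
  obtain ⟨K, hK⟩ := eventually_atTop.1 hc
  have h : ∀ j, weightProduct M c (j + K) = M ^ j * weightProduct M c K := by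
    intro j
    induction j with
    | zero => simp
    | succ j ih =>
      rw [add_right_comm, weightProduct, hK _ (Nat.le_add_left _ _), ih]
      simp only [Bool.false_eq_true, if_false]
      ring
  rw [← summable_nat_add_iff K]
  simp only [h, mul_inv, ← inv_pow]
  exact (summable_geometric_of_lt_one (by positivity) (inv_lt_one_of_one_lt₀ hM)).mul_right _

theorem continuous_weightProduct (M : ℝ) (m n : ℕ) :
    Continuous fun α : ℕ → ℕ → Bool => weightProduct M (α m) n := by
  induction n with
  | zero => exact continuous_const
  | succ n ih =>
    have hclopen : IsClopen {α : ℕ → ℕ → Bool | α m n = true} :=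
      (isClopen_discrete {true}).preimage
        ((continuous_apply n).comp (continuous_apply (A := fun _ : ℕ => ℕ → Bool) m))
    refine Continuous.if ?_ continuous_const (continuous_const.mul ih)
    rw [hclopen.frontier_eq]
    simp

/-- `T` is the direct sum of the weighted backward shifts coded by the columns of `α`, acting on the
double sequence `b` of basis vectors. -/
def IsShiftSum (b : HilbertBasis (ℕ × ℕ) ℂ H) (M : ℝ) (α : ℕ → ℕ → Bool) (T : H →L[ℂ] H) : Prop :=
  ∀ x m n, b.repr (T x) (m, n) =
    (weightProduct M (α m) (n + 1) / weightProduct M (α m) n : ℝ) * b.repr x (m, n + 1)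

theorem exists_isShiftSum (b : HilbertBasis (ℕ × ℕ) ℂ H) {M : ℝ} (hM : 1 ≤ M)
    (α : ℕ → ℕ → Bool) : ∃ T : H →L[ℂ] H, ‖T‖ ≤ M ∧ IsShiftSum b M α T := by
  obtain ⟨T, hT, h⟩ := b.exists_weightedComp (σ := fun i => (i.1, i.2 + 1))
    (fun i j h => by simpa [Prod.ext_iff] using h)
    (w := fun i => weightProduct M (α i.1) (i.2 + 1) / weightProduct M (α i.1) i.2)
    (zero_le_one.trans hM) fun i => by
      have h1 := one_le_weightProduct hM (α i.1) i.2
      have h2 := one_le_weightProduct hM (α i.1) (i.2 + 1)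
      rw [abs_of_nonneg (by positivity), div_le_iff₀ (by positivity)]
      exact weightProduct_succ_le hM _ _
  exact ⟨T, hT, fun x m n => h x (m, n)⟩

namespace IsShiftSum

variable {b : HilbertBasis (ℕ × ℕ) ℂ H} {M : ℝ} {α : ℕ → ℕ → Bool} {T : H →L[ℂ] H}

theorem apply_basis_zero (hT : IsShiftSum b M α T) (m : ℕ) : T (b (m, 0)) = 0 := by
  refine b.repr.injective (lp.ext (funext fun ⟨k, n⟩ => ?_))
  rw [hT, b.repr_self, lp.single_apply_ne _ _ _ (by simp)]
  simp

theorem apply_basis_succ (hT : IsShiftSum b M α T) (m n : ℕ) : T (b (m, n + 1)) =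
    ((weightProduct M (α m) (n + 1) / weightProduct M (α m) n : ℝ) : ℂ) • b (m, n) := by
  refine b.repr.injective (lp.ext (funext fun ⟨k, l⟩ => ?_))
  rw [hT, map_smul, b.repr_self, b.repr_self, lp.coeFn_smul, Pi.smul_apply, smul_eq_mul]
  by_cases h : (k, l) = (m, n)
  · obtain ⟨rfl, rfl⟩ := Prod.mk.inj h
    rw [lp.single_apply_self, lp.single_apply_self]
  · rw [lp.single_apply_ne _ _ _ h, lp.single_apply_ne _ _ _ (by simpa using h)]
    simp

theorem adjoint_apply_basis [CompleteSpace H] (hT : IsShiftSum b M α T) (m n : ℕ) :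
    ContinuousLinearMap.adjoint T (b (m, n)) =
      ((weightProduct M (α m) (n + 1) / weightProduct M (α m) n : ℝ) : ℂ) • b (m, n + 1) := by
  refine ext_inner_right ℂ fun x => ?_
  rw [ContinuousLinearMap.adjoint_inner_left, inner_smul_left, ← b.repr_apply_apply,
    ← b.repr_apply_apply, hT, Complex.conj_ofReal]

/-- The coordinates of a shift sum are those of the unweighted shift after multiplication by the
products of the weights. -/
theorem repr_pow_apply (hT : IsShiftSum b M α T) (hM : 1 ≤ M) (m n k : ℕ) (x : H) :
    weightProduct M (α m) n * b.repr ((T ^ k) x) (m, n) =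
      weightProduct M (α m) (n + k) * b.repr x (m, n + k) := by
  induction k generalizing x with
  | zero => simp
  | succ k ih =>
    have h : (weightProduct M (α m) (n + k) : ℂ) ≠ 0 := by
      have := one_le_weightProduct hM (α m) (n + k)
      exact_mod_cast (by positivity : weightProduct M (α m) (n + k) ≠ 0)
    rw [pow_succ, mul_apply_eq_comp, ih, hT, add_assoc]
    push_cast
    field_simp

/-- If all columns of `α` are eventually `false`, the products of the weights grow geometrically,
so that all basis vectors have summable backward orbits. -/
theorem isChaotic [CompleteSpace H] [TopologicalSpace.SeparableSpace H] [Nontrivial H]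
    (hT : IsShiftSum b M α T) (hM : 1 < M) (hα : ∀ m, ∀ᶠ n in atTop, α m n = false) :
    IsChaotic T := by
  refine isChaotic_of_dense_summableBackwardOrbits ?_
  have hd : Dense (Submodule.span ℂ (range b) : Set H) :=
    Submodule.dense_iff_topologicalClosure_eq_top.2 b.dense_span
  refine hd.mono (Submodule.span_le.2 ?_)
  rintro _ ⟨⟨m, n⟩, rfl⟩
  have hpos : ∀ j, 0 < weightProduct M (α m) j := fun j =>
    zero_lt_one.trans_le (one_le_weightProduct hM.le _ _)
  have hzero : (T ^ (n + 1)) (b (m, n)) = 0 := by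
    induction n with
    | zero => simpa using hT.apply_basis_zero m
    | succ n ih => rw [pow_succ, mul_apply_eq_comp, hT.apply_basis_succ, map_smul, ih, smul_zero]
  refine ⟨?_, fun j => ((weightProduct M (α m) n / weightProduct M (α m) (n + j) : ℝ) : ℂ) •
    b (m, n + j), ?_, fun j => ?_, ?_⟩
  · filter_upwards [eventually_ge_atTop (n + 1)] with k hk
    rw [← Nat.sub_add_cancel hk, pow_add, mul_apply_eq_comp, hzero, map_zero]
  · simp [(hpos n).ne']
  · have h2 := (hpos (n + j + 1)).ne'
    rw [map_smul, ← add_assoc, hT.apply_basis_succ, smul_smul, ← Complex.ofReal_mul,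
      div_mul_div_cancel₀ h2]
  · have hs := ((summable_nat_add_iff n).2 (summable_inv_weightProduct hM (hα m))).mul_left
      (weightProduct M (α m) n)
    refine hs.congr fun j => ?_
    rw [norm_smul, Complex.norm_real, b.orthonormal.1, mul_one, Real.norm_of_nonneg
      (div_nonneg (hpos _).le (hpos _).le), div_eq_mul_inv, add_comm]

/-- If the column `m` of `α` takes the value `true` infinitely often, then along each progression
`N, 2N, …` the products of its weights are infinitely often at most `M ^ N`; since the coordinates of
a vector tend to `0`, the coordinate `(m, 0)` of a point of period `N` vanishes. -/
theorem repr_eq_zero_of_mem_periodicPts (hT : IsShiftSum b M α T) (hM : 1 ≤ M) {m : ℕ}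
    (hα : ∃ᶠ n in atTop, α m n = true) {x : H} (hx : x ∈ Function.periodicPts (T : H → H)) :
    b.repr x (m, 0) = 0 := by
  obtain ⟨N, hN, hxN⟩ := hx
  have hbound : ∃ᶠ k in atTop, ‖b.repr x (m, 0)‖ ≤ M ^ N * ‖b.repr x (m, k * N)‖ := by
    refine frequently_atTop.2 fun K => ?_
    obtain ⟨i, hi, hmi⟩ := frequently_atTop.1 hα (K * N)
    -- The first multiple of `N` beyond `i`.
    refine ⟨i / N + 1, ((Nat.le_div_iff_mul_le hN).2 hi).trans (Nat.le_succ _), ?_⟩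
    have h1 : i < (i / N + 1) * N := by
      rw [add_mul, one_mul]
      exact Nat.lt_div_mul_add hN
    obtain ⟨j, hj⟩ := Nat.exists_eq_add_of_le (Nat.succ_le_of_lt h1)
    have hjN : j ≤ N := by
      have := Nat.div_mul_le_self i N
      rw [add_mul, one_mul] at hj
      omega
    have hper : (T ^ ((i / N + 1) * N)) x = x := by
      rw [FunLike.coe_pow_eq_iterate]
      exact hxN.const_mul _
    have h2 := hT.repr_pow_apply hM m 0 ((i / N + 1) * N) x
    rw [hper, zero_add] at h2
    simp only [weightProduct, Complex.ofReal_one, one_mul] at h2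
    rw [h2, norm_mul, Complex.norm_real,
      Real.norm_of_nonneg (zero_le_one.trans (one_le_weightProduct hM _ _))]
    gcongr
    rw [hj]
    exact (weightProduct_add_le hM hmi j).trans (pow_le_pow_right₀ hM hjN)
  have hlim : Tendsto (fun k => M ^ N * ‖b.repr x (m, k * N)‖) atTop (𝓝 0) := by
    have h1 := (b.hasSum_repr x).summable.tendsto_cofinite_zero.norm
    have hinj : Function.Injective fun k : ℕ => (m, k * N) := fun k l h =>
      mul_left_injective₀ hN.ne' (Prod.mk.inj h).2
    have h2 := (h1.comp hinj.tendsto_cofinite).const_mul (M ^ N)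
    rw [Nat.cofinite_eq_atTop] at h2
    simpa [norm_smul, b.orthonormal.1] using! h2
  exact norm_le_zero_iff.1 (ge_of_tendsto_of_frequently hlim hbound)

theorem eventually_eq_false_of_isChaotic (hT : IsShiftSum b M α T) (hM : 1 ≤ M)
    (h : IsChaotic T) (m : ℕ) : ∀ᶠ n in atTop, α m n = false := by
  by_contra hm
  have hm' : ∃ᶠ n in atTop, α m n = true := by simpa [Filter.Frequently] using hm
  have hc : IsClosed {x : H | b.repr x (m, 0) = 0} := by
    simp only [b.repr_apply_apply]
    exact isClosed_eq (by fun_prop) continuous_const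
  have hsub : Function.periodicPts (T : H → H) ⊆ {x : H | b.repr x (m, 0) = 0} :=
    fun x hx => hT.repr_eq_zero_of_mem_periodicPts hM hm' hx
  have h0 : b.repr (b (m, 0)) (m, 0) = 0 := closure_minimal hsub hc (h.2 (b (m, 0)))
  rw [b.repr_self, lp.single_apply_self] at h0
  exact one_ne_zero h0

end IsShiftSum

theorem continuous_of_isShiftSum [CompleteSpace H] {b : HilbertBasis (ℕ × ℕ) ℂ H} {M : ℝ}
    (hM : 1 ≤ M) {Φ : (ℕ → ℕ → Bool) → OperatorBall H M} (hΦ : ∀ α, IsShiftSum b M α (Φ α)) :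
    Continuous[_, ballSOTStar H M] Φ := by
  have hw : ∀ m n, Continuous fun α : ℕ → ℕ → Bool =>
      ((weightProduct M (α m) (n + 1) / weightProduct M (α m) n : ℝ) : ℂ) := fun m n =>
    Complex.continuous_ofReal.comp ((continuous_weightProduct M m _).div
      (continuous_weightProduct M m _)
      fun α => (zero_lt_one.trans_le (one_le_weightProduct hM _ _)).ne')
  refine continuous_ballSOTStar_iff.2 ⟨?_, ?_⟩
  · refine continuous_clm_apply_of_dense_span (fun α => (Φ α).2) b.dense_span ?_
    rintro _ ⟨⟨m, _ | n⟩, rfl⟩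
    · simpa only [(hΦ _).apply_basis_zero] using continuous_const
    · simp only [(hΦ _).apply_basis_succ]
      exact (hw m n).smul continuous_const
  · refine continuous_clm_apply_of_dense_span
      (fun α => (LinearIsometryEquiv.norm_map _ _).trans_le (Φ α).2) b.dense_span ?_
    rintro _ ⟨⟨m, n⟩, rfl⟩
    simp only [(hΦ _).adjoint_apply_basis]
    exact (hw m n).smul continuous_const

/-- The map sending `α` to its shift sum is continuous, and the preimage of the set of chaotic
operators consists of the `α` all of whose columns are eventually `false`, which is not a countable
union of `Gδ` sets. -/
theorem not_isSigma0_three_ballSOTStar_chaoticSet [CompleteSpace H]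
    [TopologicalSpace.SeparableSpace H] (hH : ¬ FiniteDimensional ℂ H) {M : ℝ} (hM : 1 < M) :
    ¬ IsSigma0 (ballSOTStar H M) 3 (chaoticSet H M) := by
  intro hS
  obtain ⟨b⟩ := exists_hilbertBasis_of_countable_infinite hH (ℕ × ℕ)
  have : Nontrivial H := ⟨b (0, 0), 0, b.orthonormal.ne_zero _⟩
  choose T hTM hT using exists_isShiftSum b hM.le
  let Φ : (ℕ → ℕ → Bool) → OperatorBall H M := fun α => ⟨T α, hTM α⟩
  let := ballSOTStar H M
  obtain ⟨B, hB, hΦB⟩ :=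
    hS.exists_preimage_eq_iUnion_isGδ (continuous_of_isShiftSum (Φ := Φ) hM.le hT)
  refine ne_iUnion_isGδ_of_forall_eventually_eq_false hB (hΦB ▸ ?_)
  ext α
  exact ⟨fun h => (hT α).isChaotic hM h, fun h => (hT α).eventually_eq_false_of_isChaotic hM.le h⟩

end Shifts

theorem mainTheorem11 {H : Type*} [NormedAddCommGroup H] [InnerProductSpace ℂ H]
    [CompleteSpace H] [TopologicalSpace.SeparableSpace H] (hH : ¬ FiniteDimensional ℂ H)
    (M : ℝ) (hM : 1 < M) :
    IsPi0 (ballSOT H M) 4 (chaoticSet H M) ∧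
      IsTruePi0 (ballSOTStar H M) 3 (chaoticSet H M) := by
  have : Nontrivial H := by
    by_contra h
    have := not_nontrivial_iff_subsingleton.1 h
    exact hH inferInstance
  exact ⟨isPi0_four_ballSOT_chaoticSet M, isPi0_three_ballSOTStar_chaoticSet M,
    not_isSigma0_three_ballSOTStar_chaoticSet hH hM⟩
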